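/- Let $D$ be a finite 2-in, 2-out digraph (loops and parallel edges allowed; every vertex is the initial vertex of exactly two edges and the terminal vertex of exactly two edges), with $c(D)$ connected components. A directed circuit is a nonempty cyclic sequence of pairwise distinct edges, each ending where the next begins; a directed circuit partition of $D$ is a set $P$ of directed circuits such that every edge lies on exactly one circuit of $P$; and $\mathcal P(D)$ is the set of all directed circuit partitions. A directed Euler system $C$ of $D$ is a directed circuit partition consisting of exactly one Euler circuit for each connected component of $D$. Let $R$ be a commutative ring, let $y\in R$, and let $C$ be a directed Euler system labeled by functions $\phi_C,\chi_C,\psi_C:V(D)\to R$. At each vertex, a directed circuit partition uses one of the two pairings of incoming with outgoing half-edges; for $P\in\mathcal P(D)$ let $\phi_C(P)$ be the set of vertices where $P$ uses the same pairing as $C$, and let $\chi_C(P)$ be the set of vertices where it uses the other one. Define \[ \pi(D,C)=\sum_{P\in\mathcal P(D)}\Bigl(\prod_{v\in\phi_C(P)}\phi_C(v)\Bigr)\Bigl(\prod_{v\in\chi_C(P)}\chi_C(v)\Bigr)\,y^{|P|-c(D)}. \] Let $\mathcal I(D,C)$ be the labeled interlacement graph: the simple graph on $V(D)$, with the labels of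 $C$, in which $v\neq w$ are adjacent if and only if they appear in the cyclic order $v\ldots w\ldots v\ldots w$ on one of the circuits of $C$. For a simple graph $G$ with label functions $\phi_G,\chi_G,\psi_G:V(G)\to R$, let \[ q_\lambda(G)=\sum_{P}\Bigl(\prod_{v\in\phi(P)}\phi_G(v)\Bigr)\Bigl(\prod_{v\in\chi(P)}\chi_G(v)\Bigr)\,y^{\nu(G_P)}, \] where $P$ runs over the partitions of $V(G)$ into pairwise disjoint, possibly empty sets $\phi(P),\chi(P),\psi(P)$ with $\psi(P)=\emptyset$, $G_P$ is obtained from $G$ by removing the vertices of $\phi(P)$ and attaching a loop at each vertex of $\psi(P)$, and $\nu(G_P)$ is the number of vertices of $G_P$ minus the $GF(2)$-rank of its adjacency matrix. Then \[ q_\lambda(\mathcal I(D,C))=\pi(D,C). \] -/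

import Mathlib

/-! ### Directed multigraphs, circuits and circuit partitions -/

/-- A directed graph with vertex set `V` and edge set `E`; loops and parallel edges are allowed.
Each edge `e` has an initial half-edge at `src e` and a terminal half-edge at `tgt e`. -/
structure DirectedMultigraph (V E : Type*) where
  src : E → V
  tgt : E → V

namespace DirectedMultigraph

/-- Every vertex carries exactly two terminal and exactly two initial half-edges. -/
def IsTwoInTwoOut {V E : Type*} (D : DirectedMultigraph V E) : Prop :=
  ∀ v : V, {e : E | D.tgt e = v}.ncard = 2 ∧ {e : E | D.src e = v}.ncard = 2

/-- The simple graph recording which distinct vertices are joined by an edge of either direction.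
It has the same connected components as the digraph. -/
def underlying {V E : Type*} (D : DirectedMultigraph V E) : SimpleGraph V :=
  SimpleGraph.fromRel fun v w => ∃ e : E, D.src e = v ∧ D.tgt e = w

/-- The number `c(D)` of connected components. -/
noncomputable def numComponents {V E : Type*} (D : DirectedMultigraph V E) : ℕ :=
  Nat.card D.underlying.ConnectedComponent

/-- A directed circuit: a nonempty cyclic sequence of pairwise distinct edges (no starting point is
distinguished), in which each edge ends where its cyclic successor begins. -/
def Circuit {V E : Type*} (D : DirectedMultigraph V E) : Type _ :=
  {c : Cycle E // c ≠ Cycle.nil ∧ c.Nodup ∧ c.Chain fun e f => D.tgt e = D.src f}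

noncomputable instance {V E : Type*} [Fintype E] (D : DirectedMultigraph V E) :
    Fintype D.Circuit :=
  letI : DecidableEq E := Classical.decEq E
  Fintype.ofInjective
    (fun c : D.Circuit => (⟨c.1, c.2.2.1⟩ : {s : Cycle E // s.Nodup}))
    (fun _ _ h => Subtype.ext (Subtype.mk.inj h))

/-- The edge `f` immediately follows the edge `e` on the circuit `c`
(when `c` consists of a single loop `e`, the edge `e` follows itself). -/
def Circuit.Follows {V E : Type*} [DecidableEq E] {D : DirectedMultigraph V E}
    (c : D.Circuit) (e f : E) : Prop :=
  ∃ h : e ∈ c.1, c.1.next c.2.2.1 e h = f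

/-- A family of directed circuits partitions the edge set. -/
def IsCircuitPartition {V E : Type*} (D : DirectedMultigraph V E) (P : Finset D.Circuit) : Prop :=
  ∀ e : E, ∃! c : D.Circuit, c ∈ P ∧ e ∈ c.1

/-- The set `𝒫(D)` of directed circuit partitions. -/
noncomputable def circuitPartitions {V E : Type*} [Fintype E] (D : DirectedMultigraph V E) :
    Finset (Finset D.Circuit) :=
  letI := Classical.decPred D.IsCircuitPartition
  Finset.univ.filter D.IsCircuitPartition

/-- The transition at `v` of a family of circuits: the pairing of the terminal half-edges at `v`
with the initial half-edges at `v` given by consecutive edges of the circuits. -/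
def transition {V E : Type*} [DecidableEq E] (D : DirectedMultigraph V E)
    (P : Finset D.Circuit) (v : V) : Set (E × E) :=
  {p | D.tgt p.1 = v ∧ ∃ c ∈ P, c.Follows p.1 p.2}

/-! ### Labeled directed Euler systems -/

/-- `c` is an Euler circuit of the connected component `K`: its edges are exactly those of `K`. -/
def Circuit.IsEulerCircuitOf {V E : Type*} {D : DirectedMultigraph V E} (c : D.Circuit)
    (K : D.underlying.ConnectedComponent) : Prop :=
  ∀ e : E, e ∈ c.1 ↔ D.underlying.connectedComponentMk (D.src e) = K

/-- A directed Euler system: a set of directed circuits that contains exactly one Euler circuit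
for each connected component, and nothing else. -/
def IsEulerSystem {V E : Type*} (D : DirectedMultigraph V E) (C : Finset D.Circuit) : Prop :=
  (∀ c ∈ C, ∃ K : D.underlying.ConnectedComponent, c.IsEulerCircuitOf K) ∧
    ∀ K : D.underlying.ConnectedComponent, ∃! c : D.Circuit, c ∈ C ∧ c.IsEulerCircuitOf K

/-- A directed Euler system labeled by three functions from the vertices to a ring `R`. -/
structure LabeledEulerSystem {V E : Type*} (D : DirectedMultigraph V E) (R : Type*) where
  circuits : Finset D.Circuit
  isEulerSystem : D.IsEulerSystem circuits
  phi : V → R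
  chi : V → R
  psi : V → R

/-- The vertices at which `P` involves the transition labeled `φ`: the one that `C` uses. -/
noncomputable def phiVertices {V E R : Type*} [Fintype V] [DecidableEq E]
    (D : DirectedMultigraph V E) (C : D.LabeledEulerSystem R) (P : Finset D.Circuit) : Finset V :=
  letI : DecidablePred fun v => D.transition P v = D.transition C.circuits v :=
    Classical.decPred _
  Finset.univ.filter fun v => D.transition P v = D.transition C.circuits v

/-- The vertices at which `P` involves the transition labeled `χ`: the one that is consistent with
the edge directions and not used by `C` (a vertex of a 2-in, 2-out digraph has exactly two
transitions consistent with the edge directions). -/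
noncomputable def chiVertices {V E R : Type*} [Fintype V] [DecidableEq E]
    (D : DirectedMultigraph V E) (C : D.LabeledEulerSystem R) (P : Finset D.Circuit) : Finset V :=
  letI : DecidablePred fun v => D.transition P v ≠ D.transition C.circuits v :=
    Classical.decPred _
  Finset.univ.filter fun v => D.transition P v ≠ D.transition C.circuits v

/-- The labeled directed circuit partition generating function `π(D, C)`, evaluated at `y`.
The subtraction does not truncate when `D` is 2-in, 2-out: every component has edges, and every
circuit lies in one component, so a circuit partition has at least `c(D)` circuits. -/
noncomputable def circuitPartitionFunction {V E R : Type*} [Fintype V] [Fintype E]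
    [DecidableEq E] [CommRing R] (D : DirectedMultigraph V E) (C : D.LabeledEulerSystem R)
    (y : R) : R :=
  ∑ P ∈ D.circuitPartitions,
    (∏ v ∈ D.phiVertices C P, C.phi v) * (∏ v ∈ D.chiVertices C P, C.chi v) *
      y ^ (P.card - D.numComponents)

/-- `v ≠ w` are interlaced with respect to `C`: they appear in the cyclic order
`v … w … v … w` on one of the circuits of `C`. -/
def Interlaced {V E : Type*} (D : DirectedMultigraph V E) (C : Finset D.Circuit) (v w : V) :
    Prop :=
  v ≠ w ∧ ∃ c ∈ C, ∃ l₁ l₂ l₃ l₄ : List V,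
    c.1.map D.src = ((v :: l₁ ++ w :: l₂ ++ v :: l₃ ++ w :: l₄ : List V) : Cycle V)

theorem Interlaced.symm {V E : Type*} {D : DirectedMultigraph V E} {C : Finset D.Circuit}
    {v w : V} (h : D.Interlaced C v w) : D.Interlaced C w v := by
  obtain ⟨hne, c, hc, l₁, l₂, l₃, l₄, h⟩ := h
  refine ⟨hne.symm, c, hc, l₂, l₃, l₄, l₁, h.trans ?_⟩
  rw [Cycle.coe_eq_coe]
  exact ⟨(v :: l₁).length, by
    have key := List.rotate_append_length_eq (v :: l₁) (w :: l₂ ++ v :: l₃ ++ w :: l₄)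
    simpa only [List.append_assoc, List.cons_append] using key⟩

end DirectedMultigraph

/-! ### Labeled simple graphs and the 2-label interlace polynomial -/

/-- A simple graph labeled by three functions from the vertices to a ring `R`. -/
structure LabeledGraph (V R : Type*) where
  graph : SimpleGraph V
  phi : V → R
  chi : V → R
  psi : V → R

/-- The labeled interlacement graph `ℐ(D, C)`, whose labels are those of `C`. -/
def DirectedMultigraph.interlacementGraph {V E R : Type*} (D : DirectedMultigraph V E)
    (C : D.LabeledEulerSystem R) : LabeledGraph V R where
  graph :=
    { Adj := D.Interlaced C.circuits
      symm := ⟨fun _ _ h => h.symm⟩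
      loopless := ⟨fun _ h => h.1 rfl⟩ }
  phi := C.phi
  chi := C.chi
  psi := C.psi

/-- A labeled partition of the vertex set into three disjoint (possibly empty) subsets. -/
structure LabeledPartition (V : Type*) [Fintype V] [DecidableEq V] where
  phi : Finset V
  chi : Finset V
  psi : Finset V
  disjoint_phi_chi : Disjoint phi chi
  disjoint_phi_psi : Disjoint phi psi
  disjoint_chi_psi : Disjoint chi psi
  union_eq : phi ∪ chi ∪ psi = Finset.univ

noncomputable instance {V : Type*} [Fintype V] [DecidableEq V] : Fintype (LabeledPartition V) :=
  Fintype.ofInjective (fun P : LabeledPartition V => (P.phi, P.chi, P.psi)) (by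
    rintro ⟨_, _, _, _, _, _, _⟩ ⟨_, _, _, _, _, _, _⟩ h
    simp only [Prod.mk.injEq] at h
    obtain ⟨rfl, rfl, rfl⟩ := h
    rfl)

/-- A graph without parallel edges in which loops are allowed: `Adj v v` says that `v` is looped. -/
structure LoopedGraph (V : Type*) where
  Adj : V → V → Prop
  symm : ∀ v w, Adj v w → Adj w v

/-- The adjacency matrix over `GF(2)`; a diagonal entry is `1` exactly at a looped vertex. -/
noncomputable def LoopedGraph.adjacencyMatrix {V : Type*} (H : LoopedGraph V) :
    Matrix V V (ZMod 2) :=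
  letI := Classical.propDecidable
  Matrix.of fun v w => if H.Adj v w then 1 else 0

/-- The `GF(2)`-nullity: the number of vertices minus the rank of the adjacency matrix. -/
noncomputable def LoopedGraph.nullity {V : Type*} [Fintype V] (H : LoopedGraph V) : ℕ :=
  Fintype.card V - H.adjacencyMatrix.rank

namespace LabeledGraph

/-- The graph `G_P`: remove every vertex in `φ(P)`, attach a loop at every vertex in `ψ(P)`. -/
def partitionGraph {V R : Type*} [Fintype V] [DecidableEq V] (G : LabeledGraph V R)
    (P : LabeledPartition V) : LoopedGraph {v : V // v ∉ P.phi} where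
  Adj v w := G.graph.Adj v.1 w.1 ∨ (v = w ∧ v.1 ∈ P.psi)
  symm := by
    rintro v w (h | ⟨rfl, h⟩)
    · exact Or.inl h.symm
    · exact Or.inr ⟨rfl, h⟩

/-- The 2-label interlace polynomial `q_λ(G)`, evaluated at `y`. -/
noncomputable def twoLabelInterlace {V R : Type*} [Fintype V] [DecidableEq V] [CommRing R]
    (G : LabeledGraph V R) (y : R) : R :=
  ∑ P : LabeledPartition V with P.psi = ∅,
    (∏ v ∈ P.phi, G.phi v) * (∏ v ∈ P.chi, G.chi v) * y ^ (G.partitionGraph P).nullity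

end LabeledGraph

/-! A circuit partition is the same thing as its successor permutation of the edges, the circuits
being the orbits. Let `ρ` swap the two edges ending at each vertex. Since a vertex has only two
transitions, `P` is obtained from `C` by replacing `succ e` with `succ (ρ e)` at the vertices of
`χ_C(P)`, and every subset of vertices arises exactly once. This matches the terms of the two sums;
it remains to compare exponents, that is, to prove the circuit-nullity formula `|P| = |C| + ν`,
where `|C| = c(D)`.

The number of orbits is the dimension of the space of invariant functions `x : E → GF(2)`. For `x`
invariant under `P`, let `z v = x (ρ e) + x e` be its jump at a switched vertex `v`, with `e` ending
at `v`, and zero elsewhere. Then `x` grows by `z` along `C`. Summing `z` along `C` from `e` to `ρ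
e`, vertices met twice cancel and exactly those interlaced with `v` survive
(`IsEulerSystem.potential_add`); hence `z` lies in the kernel of the interlacement matrix.
Conversely, each kernel vector integrates to such an `x` (`IsEulerSystem.exists_potential`). Jump
zero means invariance under `C`, so rank-nullity for `x ↦ z` gives the formula. -/

/-! ### Cycles as orbits, and potentials along a map -/

theorem Cycle.chain_iff_forall_next {α : Type*} [DecidableEq α] {r : α → α → Prop} {c : Cycle α}
    (hc : c.Nodup) : c.Chain r ↔ ∀ a (h : a ∈ c), r a (c.next hc a h) := by
  induction c using Quotient.inductionOn' with
  | h l =>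
  rcases l with _ | ⟨a, l⟩
  · exact ⟨fun _ b hb => (Cycle.notMem_nil b hb).elim, fun _ => Cycle.Chain.nil r⟩
  have hnd : (a :: l).Nodup := hc
  change List.IsChain r (a :: (l ++ [a])) ↔
    ∀ b (h : b ∈ a :: l), r b ((a :: l).next b h)
  rw [List.isChain_iff_getElem]
  have key : ∀ i (hi : i < (a :: l).length), (a :: (l ++ [a]))[i]'(by simp at hi ⊢; omega) =
      (a :: l)[i] := by
    intro i hi
    simp only [← List.cons_append]
    rw [List.getElem_append_left hi]
  have key' : ∀ i (hi : i < (a :: l).length), (a :: (l ++ [a]))[i + 1]'(by simp at hi ⊢; omega) =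
      (a :: l).next _ (List.getElem_mem hi) := by
    intro i hi
    rw [List.next_getElem _ hnd]
    simp only [← List.cons_append]
    by_cases h : i + 1 < (a :: l).length
    · simp only [Nat.mod_eq_of_lt h]
      rw [List.getElem_append_left h]
    · have h' : i + 1 = (a :: l).length := by omega
      simp only [h', Nat.mod_self]
      rw [List.getElem_append_right le_rfl]
      simp
  constructor
  · intro h b hb
    obtain ⟨i, hi, rfl⟩ := List.getElem_of_mem hb
    have := h i (by simp at hi ⊢; omega)
    rwa [key i hi, key' i hi] at this
  · intro h i hi
    have hi' : i < (a :: l).length := by simp at hi ⊢; omega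
    rw [key i hi', key' i hi']
    exact h _ _

theorem List.getElem_eq_iterate_of_isChain {α : Type*} {f : α → α} {a : α} {l : List α}
    (h : List.IsChain (fun x y => f x = y) (a :: l)) (i : ℕ) (hi : i < (a :: l).length) :
    (a :: l)[i] = f^[i] a := by
  rw [List.isChain_iff_getElem] at h
  induction i with
  | zero => rfl
  | succ i ih => rw [Function.iterate_succ_apply', ← ih (by omega), h i hi]

theorem Cycle.exists_eq_cons_of_mem {α : Type*} {c : Cycle α} {a : α} (h : a ∈ c) :
    ∃ l : List α, c = ((a :: l : List α) : Cycle α) := by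
  induction c using Quotient.inductionOn' with
  | h l =>
  obtain ⟨s, t, rfl⟩ := List.append_of_mem (show a ∈ l from h)
  exact ⟨t ++ s, Cycle.coe_eq_coe.2 List.isRotated_append⟩

/-- A cycle without repetitions along which `f` maps each entry to its successor is an orbit. -/
theorem Cycle.eq_periodicOrbit {α : Type*} {f : α → α} {c : Cycle α} (hc : c.Nodup)
    (h : c.Chain fun x y => f x = y) {a : α} (ha : a ∈ c) :
    c = Function.periodicOrbit f a ∧ a ∈ Function.periodicPts f := by
  obtain ⟨l, rfl⟩ := Cycle.exists_eq_cons_of_mem ha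
  rw [Cycle.chain_coe_cons] at h
  rw [Cycle.nodup_coe_iff] at hc
  have hit := List.getElem_eq_iterate_of_isChain h
  have hN : f^[l.length + 1] a = a := by
    rw [← hit _ (by simp)]; simp
  have hlt : ∀ i (hi : i < (a :: l).length), (a :: l)[i] = f^[i] a := by
    intro i hi
    rw [← hit i (by simp at hi ⊢; omega)]
    simp only [← List.cons_append]
    rw [List.getElem_append_left hi]
  have hper : a ∈ Function.periodicPts f := ⟨_, Nat.succ_pos _, hN⟩
  have hmin : Function.minimalPeriod f a = l.length + 1 := by
    refine le_antisymm (Function.IsPeriodicPt.minimalPeriod_le (Nat.succ_pos _) hN) ?_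
    -- A smaller period would make `a` reappear at that index, against `Nodup`.
    by_contra! hlt'
    have h1 := hlt _ hlt'
    rw [Function.iterate_minimalPeriod] at h1
    have h2 := (List.Nodup.getElem_inj_iff hc (hi := hlt') (hj := Nat.succ_pos _)).1 h1
    exact (Function.minimalPeriod_pos_of_mem_periodicPts hper).ne' h2
  refine ⟨?_, hper⟩
  rw [Function.periodicOrbit_def, hmin]
  congr 1
  refine List.ext_getElem (by simp) fun i hi _ => ?_
  rw [hlt i hi, List.getElem_map, List.getElem_range]

/-- Without repetitions the head fixes the amount of rotation. This makes the way a circuit is cut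
open at a given edge unique. -/
theorem List.IsRotated.eq_of_nodup_cons {α : Type*} {a : α} {l m : List α}
    (h : (a :: l) ~r (a :: m)) (hl : (a :: l).Nodup) : l = m := by
  obtain ⟨n, hn, h⟩ := List.isRotated_iff_mod.1 h
  rcases hn.lt_or_eq with hn | rfl
  · have h1 : (a :: l)[n]? = some a := by
      rw [← List.head?_rotate hn, h]; rfl
    rw [List.getElem?_eq_some_iff] at h1
    obtain ⟨_, h1⟩ := h1
    have h2 := (List.Nodup.getElem_inj_iff hl (hi := hn) (hj := Nat.succ_pos _)).1 h1
    subst h2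
    simpa using h
  · rw [List.rotate_length] at h
    simpa using h

/-- If `x` changes by `u` along `f`, then its total change along a path is the sum of `u`. -/
theorem List.IsChain.apply_eq_add_sum {α A : Type*} [AddCommGroup A] {f : α → α} {u x : α → A}
    (hx : ∀ a, x (f a) = x a + u a) {l : List α} {a b : α}
    (h : List.IsChain (fun x y => f x = y) (a :: (l ++ [b]))) :
    x b = x a + ((a :: l).map u).sum := by
  induction l generalizing a with
  | nil =>
    simp only [List.nil_append, List.isChain_pair] at h
    simp [← h, hx]
  | cons c l ih =>
    simp only [List.cons_append, List.isChain_cons_cons] at h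
    rw [ih h.2, ← h.1, hx]
    simp [add_assoc]

/-- A function whose sum over every orbit of `f` vanishes is a coboundary along `f`. -/
theorem Function.exists_potential {α A : Type*} [AddCommGroup A] {f : α → α}
    (hf : ∀ a, a ∈ Function.periodicPts f) (rep : α → α) (hrep : ∀ a, rep (f a) = rep a)
    (hrep' : ∀ a, ∃ n, f^[n] (rep a) = a) (u : α → A)
    (hu : ∀ a, ∑ i ∈ Finset.range (Function.minimalPeriod f a), u (f^[i] a) = 0) :
    ∃ x : α → A, ∀ a, x (f a) = x a + u a := by
  have hrep'' : ∀ a, ∃ n, n < Function.minimalPeriod f (rep a) ∧ f^[n] (rep a) = a := by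
    intro a
    obtain ⟨n, hn⟩ := hrep' a
    exact ⟨n % Function.minimalPeriod f (rep a),
      Nat.mod_lt _ (Function.minimalPeriod_pos_of_mem_periodicPts (hf _)),
      by rw [Function.iterate_mod_minimalPeriod_eq, hn]⟩
  choose n hn hna using hrep''
  -- Integrate `u` along the orbit from its representative to `a`.
  refine ⟨fun a => ∑ i ∈ Finset.range (n a), u (f^[i] (rep a)), fun a => ?_⟩
  have h1 : f^[n (f a)] (rep a) = f^[n a + 1] (rep a) := by
    rw [Function.iterate_succ_apply', hna a, ← hrep a, hna (f a)]
  have h2 := hn (f a)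
  rw [hrep a] at h2
  have h3 : ∑ i ∈ Finset.range (n a + 1), u (f^[i] (rep a)) =
      ∑ i ∈ Finset.range (n a), u (f^[i] (rep a)) + u a := by
    rw [Finset.sum_range_succ, hna a]
  simp only [hrep a]
  rw [← h3]
  -- Either `f a` is one step further from the representative, or the orbit has closed up; then the
  -- sum over a full period must vanish, which is `hu`.
  rcases (Nat.succ_le_of_lt (hn a)).lt_or_eq with h | h
  · have : n (f a) = n a + 1 := Function.iterate_injOn_Iio_minimalPeriod h2 h h1
    rw [this]
  · rw [Nat.succ_eq_add_one] at h
    rw [h, hu]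
    have h4 : n (f a) = 0 := by
      refine Function.iterate_injOn_Iio_minimalPeriod (x := rep a) h2
        (Function.minimalPeriod_pos_of_mem_periodicPts (hf _)) ?_
      simp only
      rw [h1, h, Function.iterate_minimalPeriod]; rfl
    rw [h4, Finset.sum_range_zero]

/-! ### Circuit partitions as permutations of the edges -/

namespace DirectedMultigraph

namespace IsCircuitPartition

/-- The circuit of a circuit partition that contains a given edge. -/
noncomputable def circuitOf {V E : Type*} {D : DirectedMultigraph V E} {P : Finset D.Circuit}
    (hP : D.IsCircuitPartition P) (e : E) : D.Circuit :=
  (hP e).choose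

variable {V E : Type*} {D : DirectedMultigraph V E} {P P' : Finset D.Circuit}

theorem circuitOf_mem (hP : D.IsCircuitPartition P) (e : E) : hP.circuitOf e ∈ P :=
  (hP e).choose_spec.1.1

theorem mem_circuitOf (hP : D.IsCircuitPartition P) (e : E) : e ∈ (hP.circuitOf e).1 :=
  (hP e).choose_spec.1.2

theorem eq_circuitOf (hP : D.IsCircuitPartition P) {c : D.Circuit} (hc : c ∈ P) {e : E}
    (he : e ∈ c.1) : c = hP.circuitOf e :=
  (hP e).choose_spec.2 c ⟨hc, he⟩

theorem exists_eq_circuitOf (hP : D.IsCircuitPartition P) {c : D.Circuit} (hc : c ∈ P) :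
    ∃ e, c = hP.circuitOf e := by
  have : ∃ e, e ∈ c.1 := by
    obtain ⟨c, hne, -⟩ := c
    induction c with
    | nil => exact (hne rfl).elim
    | cons a l => exact ⟨a, by simp⟩
  obtain ⟨e, he⟩ := this
  exact ⟨e, hP.eq_circuitOf hc he⟩

variable [DecidableEq E]

/-- The edge that follows a given edge in a circuit partition. -/
noncomputable def succ (hP : D.IsCircuitPartition P) (e : E) : E :=
  (hP.circuitOf e).1.next (hP.circuitOf e).2.2.1 e (hP.mem_circuitOf e)

theorem next_eq_succ (hP : D.IsCircuitPartition P) {c : D.Circuit} (hc : c ∈ P) {e : E}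
    (he : e ∈ c.1) : c.1.next c.2.2.1 e he = hP.succ e := by
  obtain rfl := hP.eq_circuitOf hc he
  rfl

theorem follows_iff (hP : D.IsCircuitPartition P) {e f : E} :
    (∃ c ∈ P, c.Follows e f) ↔ hP.succ e = f := by
  constructor
  · rintro ⟨c, hc, he, rfl⟩
    exact (hP.next_eq_succ hc he).symm
  · rintro rfl
    exact ⟨_, hP.circuitOf_mem e, hP.mem_circuitOf e, rfl⟩

theorem chain_succ (hP : D.IsCircuitPartition P) {c : D.Circuit} (hc : c ∈ P) :
    c.1.Chain fun e f => hP.succ e = f := by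
  rw [Cycle.chain_iff_forall_next c.2.2.1]
  exact fun e he => (hP.next_eq_succ hc he).symm

theorem src_succ (hP : D.IsCircuitPartition P) (e : E) : D.src (hP.succ e) = D.tgt e :=
  ((Cycle.chain_iff_forall_next (hP.circuitOf e).2.2.1).1 (hP.circuitOf e).2.2.2 e
    (hP.mem_circuitOf e)).symm

theorem circuitOf_succ (hP : D.IsCircuitPartition P) (e : E) :
    hP.circuitOf (hP.succ e) = hP.circuitOf e :=
  (hP.eq_circuitOf (hP.circuitOf_mem e) (Cycle.next_mem _ _ _ _)).symm

theorem circuitOf_iterate_succ (hP : D.IsCircuitPartition P) (n : ℕ) (e : E) :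
    hP.circuitOf (hP.succ^[n] e) = hP.circuitOf e := by
  induction n with
  | zero => rfl
  | succ n ih => rw [Function.iterate_succ_apply', circuitOf_succ, ih]

theorem succ_injective (hP : D.IsCircuitPartition P) : Function.Injective hP.succ := by
  intro e f h
  have hc : hP.circuitOf e = hP.circuitOf f := by
    rw [← circuitOf_succ, h, circuitOf_succ]
  have he := hP.mem_circuitOf e
  rw [hc] at he
  have h1 := hP.next_eq_succ (hP.circuitOf_mem f) he
  have h2 := hP.next_eq_succ (hP.circuitOf_mem f) (hP.mem_circuitOf f)
  refine (Cycle.prev_next _ (hP.circuitOf f).2.2.1 e he).symm.trans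
    (Eq.trans ?_ (Cycle.prev_next _ (hP.circuitOf f).2.2.1 f (hP.mem_circuitOf f)))
  congr 1
  rw [h1, h2, h]

theorem mem_periodicPts (hP : D.IsCircuitPartition P) (e : E) :
    e ∈ Function.periodicPts hP.succ :=
  (Cycle.eq_periodicOrbit (hP.circuitOf e).2.2.1 (hP.chain_succ (hP.circuitOf_mem e))
    (hP.mem_circuitOf e)).2

theorem coe_circuitOf (hP : D.IsCircuitPartition P) (e : E) :
    (hP.circuitOf e).1 = Function.periodicOrbit hP.succ e :=
  (Cycle.eq_periodicOrbit (hP.circuitOf e).2.2.1 (hP.chain_succ (hP.circuitOf_mem e))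
    (hP.mem_circuitOf e)).1

theorem circuitOf_eq_iff (hP : D.IsCircuitPartition P) {e f : E} :
    hP.circuitOf e = hP.circuitOf f ↔ ∃ n, hP.succ^[n] e = f := by
  constructor
  · intro h
    have hf := hP.mem_circuitOf f
    rwa [← h, coe_circuitOf, Function.mem_periodicOrbit_iff (hP.mem_periodicPts e)] at hf
  · rintro ⟨n, rfl⟩
    exact (hP.circuitOf_iterate_succ n e).symm

theorem subset_of_succ_eq (hP : D.IsCircuitPartition P) (hP' : D.IsCircuitPartition P')
    (h : hP.succ = hP'.succ) : P ⊆ P' := by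
  intro c hc
  obtain ⟨e, rfl⟩ := hP.exists_eq_circuitOf hc
  have : hP.circuitOf e = hP'.circuitOf e := by
    apply Subtype.ext
    rw [coe_circuitOf, coe_circuitOf, h]
  rw [this]
  exact hP'.circuitOf_mem e

theorem eq_of_succ_eq (hP : D.IsCircuitPartition P) (hP' : D.IsCircuitPartition P')
    (h : hP.succ = hP'.succ) : P = P' :=
  (hP.subset_of_succ_eq hP' h).antisymm (hP'.subset_of_succ_eq hP h.symm)

theorem transition_eq_iff (hP : D.IsCircuitPartition P) (hP' : D.IsCircuitPartition P') {v : V} :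
    D.transition P v = D.transition P' v ↔ ∀ e, D.tgt e = v → hP.succ e = hP'.succ e := by
  simp only [transition, hP.follows_iff, hP'.follows_iff, Set.ext_iff, Set.mem_ofPred_eq,
    Prod.forall, and_congr_right_iff]
  constructor
  · intro h e he
    exact ((h e _ he).2 rfl)
  · intro h e f he
    rw [h e he]

end IsCircuitPartition

/-- Every injective choice of successors is the successor function of a circuit partition. -/
theorem exists_isCircuitPartition_succ_eq {V E : Type*} [Fintype E] [DecidableEq E]
    {D : DirectedMultigraph V E} {f : E → E} (hf : Function.Injective f)
    (hfD : ∀ e, D.src (f e) = D.tgt e) :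
    ∃ (P : Finset D.Circuit) (hP : D.IsCircuitPartition P), hP.succ = f := by
  classical
  have hper : ∀ e, e ∈ Function.periodicPts f := fun e => hf.mem_periodicPts e
  have hchain : ∀ e, (Function.periodicOrbit f e).Chain fun a b => f a = b := fun e =>
    (Function.periodicOrbit_chain' _ (hper e)).2 fun n =>
      (Function.iterate_succ_apply' f n e).symm
  let orb : E → D.Circuit := fun e => ⟨Function.periodicOrbit f e,
    fun h => Function.periodicOrbit_eq_nil_iff_not_periodic_pt.1 h (hper e),
    Function.nodup_periodicOrbit,
    (hchain e).imp fun a b h => by rw [← h, hfD]⟩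
  have horb : ∀ e e', e ∈ (orb e').1 → orb e' = orb e := by
    intro e e' h
    obtain ⟨n, rfl⟩ := (Function.mem_periodicOrbit_iff (hper e')).1 h
    exact Subtype.ext (Function.periodicOrbit_apply_iterate_eq (hper e') n).symm
  have hP : D.IsCircuitPartition (Finset.univ.image orb) := by
    intro e
    refine ⟨orb e, ⟨Finset.mem_image_of_mem _ (Finset.mem_univ _),
      Function.self_mem_periodicOrbit (hper e)⟩, ?_⟩
    rintro c ⟨hc, he⟩
    obtain ⟨e', -, rfl⟩ := Finset.mem_image.1 hc
    exact horb e e' he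
  refine ⟨_, hP, funext fun e => ?_⟩
  rw [← hP.next_eq_succ (Finset.mem_image_of_mem orb (Finset.mem_univ e))
    (Function.self_mem_periodicOrbit (hper e))]
  exact ((Cycle.chain_iff_forall_next Function.nodup_periodicOrbit).1 (hchain e) e
    (Function.self_mem_periodicOrbit (hper e))).symm

/-! ### Euler systems and connected components -/

namespace IsEulerSystem

variable {V E : Type*} {D : DirectedMultigraph V E} {C : Finset D.Circuit}

theorem isCircuitPartition (hC : D.IsEulerSystem C) : D.IsCircuitPartition C := by
  intro e
  obtain ⟨c, ⟨hc, hcK⟩, huniq⟩ := hC.2 (D.underlying.connectedComponentMk (D.src e))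
  refine ⟨c, ⟨hc, (hcK e).2 rfl⟩, ?_⟩
  rintro c' ⟨hc', he⟩
  obtain ⟨K, hK⟩ := hC.1 c' hc'
  obtain rfl := (hK e).1 he
  exact huniq c' ⟨hc', hK⟩

theorem card_eq_numComponents (hC : D.IsEulerSystem C) : C.card = D.numComponents := by
  choose g hg using fun K => (hC.2 K).exists
  have hbij : Function.Bijective fun K => (⟨g K, (hg K).1⟩ : {c // c ∈ C}) := by
    constructor
    · intro K K' h
      have h' : g K = g K' := congrArg Subtype.val h
      obtain ⟨e, he⟩ := hC.isCircuitPartition.exists_eq_circuitOf (hg K).1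
      have hmem : e ∈ (g K).1 := he ▸ hC.isCircuitPartition.mem_circuitOf e
      rw [← ((hg K).2 e).1 hmem, ((hg K').2 e).1 (h' ▸ hmem)]
    · rintro ⟨c, hc⟩
      obtain ⟨K, hK⟩ := hC.1 c hc
      exact ⟨K, Subtype.ext ((hC.2 K).unique (hg K) ⟨hc, hK⟩)⟩
  rw [numComponents, Nat.card_eq_of_bijective _ hbij, Nat.card_eq_fintype_card, Fintype.card_coe]

/-- The ends of an edge lie in one component, so an Euler circuit containing one edge that ends at a
vertex contains all of them. With two such edges, every vertex is met twice or not at all by a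
circuit of `C`. -/
theorem circuitOf_eq_of_tgt_eq (hC : D.IsEulerSystem C) {e f : E} (h : D.tgt e = D.tgt f) :
    hC.isCircuitPartition.circuitOf e = hC.isCircuitPartition.circuitOf f := by
  have key : ∀ g, D.underlying.connectedComponentMk (D.src g) =
      D.underlying.connectedComponentMk (D.tgt g) := by
    intro g
    by_cases hg : D.src g = D.tgt g
    · rw [hg]
    · refine SimpleGraph.ConnectedComponent.sound (SimpleGraph.Adj.reachable ?_)
      exact (SimpleGraph.fromRel_adj _ _ _).2 ⟨hg, Or.inl ⟨g, rfl, rfl⟩⟩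
  obtain ⟨K, hK⟩ := hC.1 _ (hC.isCircuitPartition.circuitOf_mem e)
  refine hC.isCircuitPartition.eq_circuitOf (hC.isCircuitPartition.circuitOf_mem e) ?_
  rw [hK, key, ← h, ← key, ← hK]
  exact hC.isCircuitPartition.mem_circuitOf e

end IsEulerSystem

end DirectedMultigraph

/-! ### Interlacement read off from an Euler circuit -/

namespace DirectedMultigraph

/-- The two cyclic words differ by a shift of one step. Interlacement can thus be read from targets,
on which `ρ` acts. -/
theorem Circuit.map_src_eq_map_tgt {V E : Type*} {D : DirectedMultigraph V E} (c : D.Circuit) :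
    c.1.map D.src = c.1.map D.tgt := by
  obtain ⟨c, -, -, hc⟩ := c
  induction c with
  | nil => rfl
  | cons a l =>
    simp only [Cycle.map_coe]
    rw [Cycle.chain_coe_cons] at hc
    have : ∀ (l : List E) (a b : E), List.IsChain (fun e f => D.tgt e = D.src f) (a :: (l ++ [b])) →
        (a :: l).map D.tgt = l.map D.src ++ [D.src b] := by
      intro l
      induction l with
      | nil => intro a b h; simpa using h
      | cons c l ih =>
        intro a b h
        simp only [List.cons_append, List.isChain_cons_cons] at h
        rw [List.map_cons, ih c b h.2, h.1]
        rfl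
    rw [this l a a hc, List.map_cons]
    exact Cycle.coe_cons_eq_coe_append _ _

/-- `ρ` exchanges the two edges that end at each vertex. -/
structure IsTargetPartner {V E : Type*} (D : DirectedMultigraph V E) (ρ : E → E) : Prop where
  ne : ∀ e, ρ e ≠ e
  tgt : ∀ e, D.tgt (ρ e) = D.tgt e
  eq_or_eq : ∀ e f, D.tgt f = D.tgt e → f = e ∨ f = ρ e

theorem IsTargetPartner.involutive {V E : Type*} {D : DirectedMultigraph V E} {ρ : E → E}
    (hρ : D.IsTargetPartner ρ) : Function.Involutive ρ := by
  intro e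
  rcases hρ.eq_or_eq (ρ e) e (hρ.tgt e).symm with h | h
  · exact (hρ.ne e h.symm).elim
  · exact h.symm

theorem IsTwoInTwoOut.exists_isTargetPartner {V E : Type*} {D : DirectedMultigraph V E}
    (hD : D.IsTwoInTwoOut) : ∃ ρ, D.IsTargetPartner ρ := by
  have h : ∀ e, ∃ f, f ≠ e ∧ D.tgt f = D.tgt e ∧ ∀ g, D.tgt g = D.tgt e → g = e ∨ g = f := by
    intro e
    obtain ⟨a, b, hab, hs⟩ := Set.ncard_eq_two.1 (hD (D.tgt e)).1
    have hm : ∀ g, D.tgt g = D.tgt e ↔ g = a ∨ g = b := fun g => Set.ext_iff.1 hs g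
    rcases (hm e).1 rfl with rfl | rfl
    · exact ⟨b, hab.symm, (hm b).2 (Or.inr rfl), fun g hg => (hm g).1 hg⟩
    · exact ⟨a, hab, (hm a).2 (Or.inl rfl), fun g hg => ((hm g).1 hg).symm⟩
  choose ρ h1 h2 h3 using h
  exact ⟨ρ, h1, h2, h3⟩

theorem IsTwoInTwoOut.surjective_tgt {V E : Type*} {D : DirectedMultigraph V E}
    (hD : D.IsTwoInTwoOut) : Function.Surjective D.tgt := by
  intro v
  obtain ⟨a, b, -, hs⟩ := Set.ncard_eq_two.1 (hD v).1
  exact ⟨a, (Set.ext_iff.1 hs a).2 (Or.inl rfl)⟩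

/-- Two vertices are interlaced if and only if the second one is met both between the two edges
that end at the first one, and after them. -/
theorem IsEulerSystem.interlaced_iff {V E : Type*} {D : DirectedMultigraph V E}
    {C : Finset D.Circuit} (hC : D.IsEulerSystem C) {ρ : E → E} (hρ : D.IsTargetPartner ρ)
    {c : D.Circuit} (hc : c ∈ C) {e : E} {l m : List E}
    (hl : c.1 = ((e :: l ++ ρ e :: m : List E) : Cycle E)) (w : V) :
    D.Interlaced C (D.tgt e) w ↔ ∃ f ∈ l, ∃ g ∈ m, D.tgt f = w ∧ D.tgt g = w := by
  have hnd : (e :: l ++ ρ e :: m).Nodup := by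
    have := c.2.2.1
    rwa [hl, Cycle.nodup_coe_iff] at this
  constructor
  · rintro ⟨hne, c', hc', l₁, l₂, l₃, l₄, h⟩
    rw [c'.map_src_eq_map_tgt] at h
    -- Lift the rotation of the vertex word to the edges, so that the four marked visits become four
    -- edges.
    obtain ⟨L, hL, hLmap⟩ : ∃ L : List E, c'.1 = L ∧
        L.map D.tgt = D.tgt e :: l₁ ++ w :: l₂ ++ D.tgt e :: l₃ ++ w :: l₄ := by
      clear hc'
      obtain ⟨c', hc'⟩ := c'
      induction c' using Quotient.inductionOn' with
      | h L =>
      obtain ⟨n, hn⟩ := Cycle.coe_eq_coe.1 h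
      refine ⟨L.rotate n, ?_, ?_⟩
      · exact Cycle.coe_eq_coe.2 ⟨n, rfl⟩
      · rw [List.map_rotate, hn]
    simp only [List.map_eq_append_iff, List.map_eq_cons_iff] at hLmap
    obtain ⟨_, _, rfl, ⟨_, _, rfl, ⟨_, _, rfl, ⟨g₁, n₁, rfl, hg₁, -⟩, ⟨h₁, n₂, rfl, hh₁, -⟩⟩,
      ⟨g₂, n₃, rfl, hg₂, -⟩⟩, ⟨h₂, n₄, rfl, hh₂, -⟩⟩ := hLmap
    have hnd' : (g₁ :: n₁ ++ h₁ :: n₂ ++ g₂ :: n₃ ++ h₂ :: n₄).Nodup := by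
      have := c'.2.2.1
      rwa [hL, Cycle.nodup_coe_iff] at this
    have hg₁₂ : g₁ ≠ g₂ := by
      rintro rfl
      simp at hnd'
    have key : ∀ {p q : List E}, c.1 = ((e :: p ++ ρ e :: q : List E) : Cycle E) → l = p ∧ m = q := by
      intro p q hpq
      rw [hl, Cycle.coe_eq_coe] at hpq
      have := hpq.eq_of_nodup_cons hnd
      simp only [List.cons_append, List.nodup_cons, List.nodup_append, List.mem_cons] at hnd
      obtain ⟨h1, -, h2⟩ := (List.append_cons_inj_of_notMem (a₁ := ρ e) (a₂ := ρ e)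
        (fun h => hnd.2.2.2 _ h _ (Or.inl rfl) rfl) hnd.2.2.1.1).1 this
      exact ⟨h1, h2⟩
    have hcc : c = c' := by
      have h1 : g₁ ∈ c'.1 := by rw [hL]; simp
      rw [hC.isCircuitPartition.eq_circuitOf hc' h1, hC.circuitOf_eq_of_tgt_eq hg₁]
      exact hC.isCircuitPartition.eq_circuitOf hc (by rw [hl]; simp)
    subst hcc
    -- The first visit to `D.tgt e` is made by `e` or by `ρ e`; in the second case the two arcs
    -- change roles.
    rcases hρ.eq_or_eq e g₁ hg₁ with rfl | rfl
    · obtain rfl := (hρ.eq_or_eq g₁ g₂ hg₂).resolve_left hg₁₂.symm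
      obtain ⟨rfl, rfl⟩ := key (p := n₁ ++ h₁ :: n₂) (q := n₃ ++ h₂ :: n₄) (by rw [hL]; simp)
      exact ⟨h₁, by simp, h₂, by simp, hh₁, hh₂⟩
    · obtain rfl := (hρ.eq_or_eq e g₂ hg₂).resolve_right hg₁₂.symm
      obtain ⟨rfl, rfl⟩ := key (p := n₃ ++ h₂ :: n₄) (q := n₁ ++ h₁ :: n₂) (by
        rw [hL, Cycle.coe_eq_coe]
        have := List.isRotated_append (l := ρ g₂ :: n₁ ++ h₁ :: n₂) (l' := g₂ :: n₃ ++ h₂ :: n₄)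
        simpa using this)
      exact ⟨h₂, by simp, h₁, by simp, hh₂, hh₁⟩
  · rintro ⟨f, hf, g, hg, rfl, hgf⟩
    refine ⟨fun h => ?_, c, hc, ?_⟩
    · rcases hρ.eq_or_eq e f h.symm with rfl | rfl
      · simp_all
      · simp only [List.cons_append, List.nodup_cons, List.nodup_append] at hnd
        exact hnd.2.2.2 _ hf _ (by simp) rfl
    · obtain ⟨l₁, l₂, rfl⟩ := List.append_of_mem hf
      obtain ⟨l₃, l₄, rfl⟩ := List.append_of_mem hg
      refine ⟨l₁.map D.tgt, l₂.map D.tgt, l₃.map D.tgt, l₄.map D.tgt, ?_⟩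
      rw [c.map_src_eq_map_tgt, hl]
      simp [hgf, hρ.tgt]

/-- The change of a potential between the two edges that end at a vertex. -/
theorem IsEulerSystem.potential_add {V E A : Type*} [Fintype V] [DecidableEq E] [CommRing A]
    [CharP A 2] {D : DirectedMultigraph V E}
    {C : Finset D.Circuit} (hC : D.IsEulerSystem C) {ρ : E → E} (hρ : D.IsTargetPartner ρ)
    [∀ v w, Decidable (D.Interlaced C v w)] (z : V → A) (x : E → A)
    (hx : ∀ e, x (hC.isCircuitPartition.succ e) = x e + z (D.tgt e)) (e : E) :
    x (ρ e) + x e = z (D.tgt e) + ∑ w with D.Interlaced C (D.tgt e) w, z w := by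
  classical
  have hCP := hC.isCircuitPartition
  set c := hCP.circuitOf e with hc
  have hcC : c ∈ C := hCP.circuitOf_mem e
  have hmem : ∀ f, f ∈ c.1 → ρ f ∈ c.1 := by
    intro f hf
    rw [hCP.eq_circuitOf hcC hf, ← hC.circuitOf_eq_of_tgt_eq (hρ.tgt f)]
    exact hCP.mem_circuitOf _
  obtain ⟨l', hl'⟩ := Cycle.exists_eq_cons_of_mem (hCP.mem_circuitOf e)
  rw [← hc] at hl'
  have hρe : ρ e ∈ l' := by
    have := hmem e (hCP.mem_circuitOf e)
    rw [hl', Cycle.mem_coe_iff, List.mem_cons] at this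
    exact this.resolve_left (hρ.ne e)
  obtain ⟨l, m, rfl⟩ := List.append_of_mem hρe
  have hnd := c.2.2.1
  rw [hl', Cycle.nodup_coe_iff] at hnd
  simp only [List.nodup_cons, List.nodup_append, List.mem_cons, List.mem_append] at hnd
  have hchain := hCP.chain_succ hcC
  rw [hl', Cycle.chain_coe_cons] at hchain
  have hchain' : List.IsChain (fun a b => hCP.succ a = b) (e :: (l ++ [ρ e])) :=
    hchain.prefix ⟨m ++ [e], by simp⟩
  have hsum := hchain'.apply_eq_add_sum hx
  -- Edges of `l` whose partner is also in `l` cancel in pairs. The others have their partner in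
  -- `m`, and their targets are the interlaced vertices, each occurring once.
  have hl : (l.map fun f => z (D.tgt f)).sum = ∑ w with D.Interlaced C (D.tgt e) w, z w := by
    rw [← List.sum_toFinset _ hnd.2.1,
      ← Finset.sum_filter_add_sum_filter_not _ (fun f => ρ f ∈ l)]
    have h0 : ∑ f ∈ l.toFinset with ρ f ∈ l, z (D.tgt f) = 0 := by
      refine Finset.sum_involution (fun f _ => ρ f) ?_ ?_ ?_ ?_
      · intro f _
        rw [hρ.tgt, CharTwo.add_self_eq_zero]
      · intro f _ _
        exact hρ.ne f
      · intro f hf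
        simp only [Finset.mem_filter, List.mem_toFinset] at hf ⊢
        exact ⟨hf.2, by rw [hρ.involutive f]; exact hf.1⟩
      · intro f _
        exact hρ.involutive f
    rw [h0, zero_add]
    have hcross : ∀ f ∈ l, ρ f ∉ l → ρ f ∈ m := by
      intro f hf hf'
      have h1 := hmem f (by rw [hl']; simp [hf])
      rw [hl', Cycle.mem_coe_iff] at h1
      simp only [List.mem_cons, List.mem_append] at h1
      rcases h1 with h1 | h1 | h1 | h1
      · rw [← h1, hρ.involutive f] at hnd
        exact (hnd.2.2.2 f hf f (Or.inl rfl) rfl).elim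
      · exact (hf' h1).elim
      · rw [hρ.involutive.injective h1] at hf
        exact (hnd.1 (Or.inl hf)).elim
      · exact h1
    have hdisj : ∀ f ∈ l, f ∉ m := fun f hf hf' => hnd.2.2.2 f hf f (Or.inr hf') rfl
    symm
    have himage : Finset.univ.filter (D.Interlaced C (D.tgt e)) =
        (l.toFinset.filter fun f => ρ f ∉ l).image D.tgt := by
      ext w
      simp only [Finset.mem_filter, Finset.mem_univ, true_and, Finset.mem_image, List.mem_toFinset,
        hC.interlaced_iff hρ hcC hl' w]
      constructor
      · rintro ⟨f, hf, g, hg, rfl, hgf⟩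
        refine ⟨f, ⟨hf, fun h => ?_⟩, rfl⟩
        rcases hρ.eq_or_eq f g hgf with rfl | rfl
        · exact hdisj _ hf hg
        · exact hdisj _ h hg
      · rintro ⟨f, ⟨hf, hf'⟩, rfl⟩
        exact ⟨f, hf, ρ f, hcross f hf hf', rfl, hρ.tgt f⟩
    rw [himage, Finset.sum_image]
    intro f hf g hg hfg
    simp only [Finset.coe_filter, List.mem_toFinset, Set.mem_ofPred_eq] at hf hg
    rcases hρ.eq_or_eq f g hfg.symm with rfl | rfl
    · rfl
    · exact (hf.2 hg.1).elim
  rw [hsum, List.map_cons, List.sum_cons, hl, add_comm (x e), add_assoc, CharTwo.add_self_eq_zero,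
    add_zero]

end DirectedMultigraph

/-! ### Invariant functions and the circuit-nullity formula -/

/-- The functions that are constant along the orbits of `f`. -/
def Function.invariants {E : Type*} (F : Type*) [Field F] (f : E → E) : Submodule F (E → F) where
  carrier := {x | ∀ e, x (f e) = x e}
  add_mem' hx hy e := by simp [hx e, hy e]
  zero_mem' _ := rfl
  smul_mem' a x hx e := by simp [hx e]

theorem Function.mem_invariants {E F : Type*} [Field F] {f : E → E} {x : E → F} :
    x ∈ Function.invariants F f ↔ ∀ e, x (f e) = x e :=
  Iff.rfl

theorem Function.apply_iterate_of_mem_invariants {E F : Type*} [Field F] {f : E → E} {x : E → F}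
    (hx : x ∈ Function.invariants F f) (n : ℕ) (e : E) : x (f^[n] e) = x e := by
  induction n with
  | zero => rfl
  | succ n ih => rw [Function.iterate_succ_apply', Function.mem_invariants.1 hx, ih]

theorem LoopedGraph.nullity_eq_finrank_ker {V : Type*} [Fintype V] (H : LoopedGraph V) :
    H.nullity = Module.finrank (ZMod 2) (LinearMap.ker H.adjacencyMatrix.mulVecLin) := by
  have h := LinearMap.finrank_range_add_finrank_ker H.adjacencyMatrix.mulVecLin
  rw [Module.finrank_fintype_fun_eq_card] at h
  rw [nullity, Matrix.rank, ← h, Nat.add_sub_cancel_left]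

namespace DirectedMultigraph

/-- The circuits are the orbits of `succ`, so the invariant functions are the pullbacks along the
surjection from edges to circuits. -/
theorem IsCircuitPartition.finrank_invariants_succ {V E F : Type*} [Fintype E] [DecidableEq E]
    [Field F] {D : DirectedMultigraph V E} {P : Finset D.Circuit} (hP : D.IsCircuitPartition P) :
    Module.finrank F (Function.invariants F hP.succ) = P.card := by
  let π : E → P := fun e => ⟨hP.circuitOf e, hP.circuitOf_mem e⟩
  have hπ : Function.Surjective π := by
    rintro ⟨c, hc⟩
    obtain ⟨e, rfl⟩ := hP.exists_eq_circuitOf hc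
    exact ⟨e, rfl⟩
  have hrange : LinearMap.range (LinearMap.funLeft F F π) = Function.invariants F hP.succ := by
    ext x
    rw [LinearMap.mem_range, Function.mem_invariants]
    constructor
    · rintro ⟨y, rfl⟩ e
      simp only [LinearMap.funLeft_apply, π, hP.circuitOf_succ]
    · intro hx
      refine ⟨fun c => x (Function.surjInv hπ c), funext fun e => ?_⟩
      rw [LinearMap.funLeft_apply]
      have h : hP.circuitOf (Function.surjInv hπ (π e)) = hP.circuitOf e :=
        congrArg Subtype.val (Function.surjInv_eq hπ (π e))
      obtain ⟨n, hn⟩ := hP.circuitOf_eq_iff.1 h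
      rw [← Function.apply_iterate_of_mem_invariants hx n, hn]
  rw [← hrange, LinearMap.finrank_range_of_inj (LinearMap.funLeft_injective_of_surjective F F π hπ),
    Module.finrank_fintype_fun_eq_card, Fintype.card_coe]

/-- The obstruction is the sum of `z` around each circuit. It vanishes in characteristic 2, because
`ρ` pairs off the edges of an Euler circuit without changing targets. -/
theorem IsEulerSystem.exists_potential {V E A : Type*} [Fintype E] [DecidableEq E]
    [CommRing A] [CharP A 2] {D : DirectedMultigraph V E} {C : Finset D.Circuit}
    (hC : D.IsEulerSystem C) {ρ : E → E} (hρ : D.IsTargetPartner ρ) (z : V → A) :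
    ∃ x : E → A, ∀ e, x (hC.isCircuitPartition.succ e) = x e + z (D.tgt e) := by
  have hCP := hC.isCircuitPartition
  let π : E → C := fun e => ⟨hCP.circuitOf e, hCP.circuitOf_mem e⟩
  have hπ : ∀ c : C, ∃ e, π e = c := by
    rintro ⟨c, hc⟩
    obtain ⟨e, rfl⟩ := hCP.exists_eq_circuitOf hc
    exact ⟨e, rfl⟩
  choose r hr using hπ
  refine Function.exists_potential hCP.mem_periodicPts (fun e => r (π e)) ?_ ?_ _ ?_
  · intro e
    simp only [π, hCP.circuitOf_succ]
  · intro e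
    exact hCP.circuitOf_eq_iff.1 (congrArg Subtype.val (hr (π e)))
  · intro e
    rw [← Finset.sum_image (s := Finset.range (Function.minimalPeriod hCP.succ e))
      (g := fun i => hCP.succ^[i] e) (f := fun f => z (D.tgt f))]
    · have hmem : ∀ f, f ∈ (Finset.range (Function.minimalPeriod hCP.succ e)).image
          (fun i => hCP.succ^[i] e) ↔ hCP.circuitOf e = hCP.circuitOf f := by
        intro f
        rw [hCP.circuitOf_eq_iff, Finset.mem_image]
        constructor
        · rintro ⟨n, -, h⟩
          exact ⟨n, h⟩
        · rintro ⟨n, h⟩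
          exact ⟨n % _, Finset.mem_range.2 (Nat.mod_lt _
            (Function.minimalPeriod_pos_of_mem_periodicPts (hCP.mem_periodicPts e))),
            by rw [Function.iterate_mod_minimalPeriod_eq, h]⟩
      refine Finset.sum_involution (fun f _ => ρ f) ?_ ?_ ?_ ?_
      · intro f _
        rw [hρ.tgt, CharTwo.add_self_eq_zero]
      · intro f _ _
        exact hρ.ne f
      · intro f hf
        rw [hmem] at hf ⊢
        rw [hf, hC.circuitOf_eq_of_tgt_eq (hρ.tgt f)]
      · intro f _
        exact hρ.involutive f
    · intro i hi j hj h
      exact Function.iterate_injOn_Iio_minimalPeriod (by simpa using hi) (by simpa using hj) h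

/-- The circuit-nullity formula: exchanging the successors of the two edges that end at `v`, for
every vertex `v` satisfying `p`, changes an Euler system into a circuit partition for which the
number of additional circuits is the nullity of the interlacement graph induced on `p`. -/
theorem IsEulerSystem.card_eq_card_add_nullity {V E : Type*} [Fintype V] [Fintype E]
    [DecidableEq E] {D : DirectedMultigraph V E} {C P : Finset D.Circuit}
    (hC : D.IsEulerSystem C) (hP : D.IsCircuitPartition P) {ρ : E → E} (hρ : D.IsTargetPartner ρ)
    (hD : Function.Surjective D.tgt) {p : V → Prop} [Fintype {v // p v}]
    (h₁ : ∀ e, p (D.tgt e) → hP.succ e = hC.isCircuitPartition.succ (ρ e))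
    (h₂ : ∀ e, ¬ p (D.tgt e) → hP.succ e = hC.isCircuitPartition.succ e)
    (H : LoopedGraph {v // p v}) (hH : ∀ v w, H.Adj v w ↔ D.Interlaced C v.1 w.1) :
    P.card = C.card + H.nullity := by
  classical
  have hCP := hC.isCircuitPartition
  obtain ⟨s, hs⟩ := hD.hasRightInverse
  -- The jump of `x` at `v`. It is symmetric in the two edges ending at `v`, so the choice of `s` is
  -- immaterial (`hΦ`).
  let Φ : (E → ZMod 2) →ₗ[ZMod 2] ({v // p v} → ZMod 2) :=
    { toFun := fun x v => x (ρ (s v.1)) + x (s v.1)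
      map_add' := fun x y => funext fun v => by simp only [Pi.add_apply]; ring
      map_smul' := fun a x => funext fun v => by
        simp only [Pi.smul_apply, smul_eq_mul, RingHom.id_apply]; ring }
  have hΦ : ∀ x e (he : p (D.tgt e)), Φ x ⟨D.tgt e, he⟩ = x (ρ e) + x e := by
    intro x e he
    change x (ρ (s (D.tgt e))) + x (s (D.tgt e)) = _
    rcases hρ.eq_or_eq e (s (D.tgt e)) (hs _) with h | h
    · rw [h]
    · rw [h, hρ.involutive e, add_comm]
  let zeroExt : ({v // p v} → ZMod 2) → V → ZMod 2 := fun z v => if h : p v then z ⟨v, h⟩ else 0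
  have hext : ∀ z v (h : p v), zeroExt z v = z ⟨v, h⟩ := fun z v h => dif_pos h
  have hext' : ∀ z v, ¬ p v → zeroExt z v = 0 := fun z v h => dif_neg h
  have hmul : ∀ z v, H.adjacencyMatrix.mulVecLin z v =
      ∑ w with D.Interlaced C v.1 w, zeroExt z w := by
    intro z v
    rw [Matrix.mulVecLin_apply, Matrix.mulVec, dotProduct, Finset.sum_filter]
    have hsub : ∑ w : {v // p v}, (if D.Interlaced C v.1 w.1 then zeroExt z w.1 else 0) =
        ∑ w, if D.Interlaced C v.1 w then zeroExt z w else 0 := by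
      rw [← Finset.sum_subtype (Finset.univ.filter p) (by simp)
        (fun w => if D.Interlaced C v.1 w then zeroExt z w else 0), Finset.sum_filter]
      refine Finset.sum_congr rfl fun w _ => ?_
      by_cases hw : p w
      · rw [if_pos hw]
      · rw [if_neg hw, hext' z w hw, ite_self]
    rw [← hsub]
    refine Finset.sum_congr rfl fun w _ => ?_
    rw [hext z w.1 w.2, LoopedGraph.adjacencyMatrix, Matrix.of_apply]
    simp only [hH]
    split_ifs <;> simp
  -- At a switched vertex the `C`-successor of `e` is the `P`-successor of `ρ e`, where `x` takes
  -- the value `x (ρ e)`.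
  have hpot : ∀ x ∈ Function.invariants (ZMod 2) hP.succ, ∀ e,
      x (hCP.succ e) = x e + zeroExt (Φ x) (D.tgt e) := by
    intro x hx e
    by_cases he : p (D.tgt e)
    · have he' : p (D.tgt (ρ e)) := by rwa [hρ.tgt]
      have h3 := h₁ (ρ e) he'
      rw [hρ.involutive e] at h3
      rw [← h3, hx, hext _ _ he, hΦ, add_comm (x (ρ e)), ← add_assoc, CharTwo.add_self_eq_zero,
        zero_add]
    · rw [← h₂ e he, hx, hext' _ _ he, add_zero]
  have hrange : LinearMap.range (Φ.domRestrict (Function.invariants (ZMod 2) hP.succ)) =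
      LinearMap.ker H.adjacencyMatrix.mulVecLin := by
    ext z
    rw [LinearMap.mem_ker, LinearMap.mem_range]
    constructor
    · rintro ⟨⟨x, hx⟩, rfl⟩
      ext v
      have h3 := hC.potential_add hρ _ x (hpot x hx) (s v.1)
      have hv : p (D.tgt (s v.1)) := by rw [hs]; exact v.2
      -- The jump is `z v` by definition and `z v` plus the interlacement sum by `potential_add`, so
      -- that sum is zero.
      rw [← hΦ _ _ hv, hext _ _ hv, left_eq_add, hs] at h3
      rw [hmul]
      exact h3
    · intro hz
      obtain ⟨x, hx⟩ := hC.exists_potential hρ (zeroExt z)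
      have h3 : ∀ e, p (D.tgt e) → x (ρ e) + x e = zeroExt z (D.tgt e) := by
        intro e he
        have h4 := congrFun hz ⟨D.tgt e, he⟩
        rw [hmul] at h4
        rw [hC.potential_add hρ _ x hx e, h4, Pi.zero_apply, add_zero]
      refine ⟨⟨x, fun e => ?_⟩, funext fun v => ?_⟩
      · by_cases he : p (D.tgt e)
        · rw [h₁ e he, hx, hρ.tgt, ← h3 e he, ← add_assoc, CharTwo.add_self_eq_zero, zero_add]
        · rw [h₂ e he, hx, hext' _ _ he, add_zero]
      · have hv : p (D.tgt (s v.1)) := by rw [hs]; exact v.2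
        have h4 := h3 _ hv
        rw [hs, hext z v.1 v.2] at h4
        exact h4
  have hker : LinearMap.ker (Φ.domRestrict (Function.invariants (ZMod 2) hP.succ)) =
      (Function.invariants (ZMod 2) hCP.succ).comap
        (Function.invariants (ZMod 2) hP.succ).subtype := by
    ext ⟨x, hx⟩
    rw [LinearMap.mem_ker, Submodule.mem_comap]
    change Φ x = 0 ↔ ∀ e, x (hCP.succ e) = x e
    constructor
    · intro h e
      rw [hpot x hx, h]
      by_cases he : p (D.tgt e)
      · rw [hext _ _ he, Pi.zero_apply, add_zero]
      · rw [hext' _ _ he, add_zero]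
    · intro h
      ext v
      have hv : p (D.tgt (s v.1)) := by rw [hs]; exact v.2
      have h3 := hpot x hx (s v.1)
      rw [h, left_eq_add, hs, hext _ _ v.2] at h3
      exact h3
  -- `e` and `ρ e` share a circuit of `C`, so a function constant on these circuits does not notice
  -- the switch.
  have hle : Function.invariants (ZMod 2) hCP.succ ≤ Function.invariants (ZMod 2) hP.succ := by
    intro x hx e
    have hx' : ∀ e, x (hCP.succ e) = x e := hx
    by_cases he : p (D.tgt e)
    · rw [h₁ e he, hx']
      obtain ⟨n, hn⟩ := hCP.circuitOf_eq_iff.1 (hC.circuitOf_eq_of_tgt_eq (hρ.tgt e))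
      conv_rhs => rw [← hn, Function.apply_iterate_of_mem_invariants hx]
    · rw [h₂ e he, hx']
  have h := LinearMap.finrank_range_add_finrank_ker
    (Φ.domRestrict (Function.invariants (ZMod 2) hP.succ))
  rw [hrange, hker, (Submodule.comapSubtypeEquivOfLe hle).finrank_eq,
    hP.finrank_invariants_succ, hCP.finrank_invariants_succ, ← H.nullity_eq_finrank_ker] at h
  rw [← h, add_comm]

/-! ### The two transitions at a vertex, and the comparison of the sums -/

theorem IsTwoInTwoOut.succ_eq_or_eq {V E : Type*} [DecidableEq E] {D : DirectedMultigraph V E}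
    (hD : D.IsTwoInTwoOut) {C P : Finset D.Circuit} (hC : D.IsCircuitPartition C)
    (hP : D.IsCircuitPartition P) {ρ : E → E} (hρ : D.IsTargetPartner ρ) (e : E) :
    hP.succ e = hC.succ e ∨ hP.succ e = hC.succ (ρ e) := by
  obtain ⟨a, b, hab, hs⟩ := Set.ncard_eq_two.1 (hD (D.tgt e)).2
  have hm : ∀ g, D.src g = D.tgt e ↔ g = a ∨ g = b := fun g => Set.ext_iff.1 hs g
  have h1 := (hm _).1 (hP.src_succ e)
  have h2 := (hm _).1 (hC.src_succ e)
  have h3 := (hm _).1 ((hC.src_succ (ρ e)).trans (hρ.tgt e))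
  have h4 : hC.succ (ρ e) ≠ hC.succ e := fun h => hρ.ne e (hC.succ_injective h)
  grind

/-- A circuit partition with another transition than `C` at a vertex exchanges there the successors
of the two edges that end at the vertex. -/
theorem IsTwoInTwoOut.succ_eq_of_transition_ne {V E : Type*} [DecidableEq E]
    {D : DirectedMultigraph V E}
    (hD : D.IsTwoInTwoOut) {C P : Finset D.Circuit} (hC : D.IsCircuitPartition C)
    (hP : D.IsCircuitPartition P) {ρ : E → E} (hρ : D.IsTargetPartner ρ) {e : E}
    (h : D.transition P (D.tgt e) ≠ D.transition C (D.tgt e)) :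
    hP.succ e = hC.succ (ρ e) := by
  rw [Ne, hP.transition_eq_iff hC] at h
  push Not at h
  obtain ⟨f, hf, hne⟩ := h
  have h1 := (hD.succ_eq_or_eq hC hP hρ f).resolve_left hne
  rcases hρ.eq_or_eq e f hf with rfl | rfl
  · exact h1
  -- If only `ρ e` were switched, `e` and `ρ e` would have the same `P`-successor.
  · refine (hD.succ_eq_or_eq hC hP hρ e).resolve_left fun h2 => ?_
    rw [hρ.involutive e, ← h2] at h1
    exact hρ.ne e (hP.succ_injective h1)

end DirectedMultigraph

theorem mainTheorem8 {V E R : Type*} [Fintype V] [DecidableEq V] [Fintype E] [DecidableEq E]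
    [CommRing R] (D : DirectedMultigraph V E) (hD : D.IsTwoInTwoOut)
    (C : D.LabeledEulerSystem R) (y : R) :
    (D.interlacementGraph C).twoLabelInterlace y = D.circuitPartitionFunction C y := by
  classical
  obtain ⟨ρ, hρ⟩ := hD.exists_isTargetPartner
  have hC := C.isEulerSystem
  have hCP := hC.isCircuitPartition
  have hphi : ∀ P v, v ∈ D.phiVertices C P ↔ D.transition P v = D.transition C.circuits v := by
    intro P v
    simp [DirectedMultigraph.phiVertices]
  have hchi : ∀ P v, v ∈ D.chiVertices C P ↔ D.transition P v ≠ D.transition C.circuits v := by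
    intro P v
    simp [DirectedMultigraph.chiVertices]
  have hmem : ∀ P, P ∈ D.circuitPartitions ↔ D.IsCircuitPartition P := by
    intro P
    simp [DirectedMultigraph.circuitPartitions]
  rw [LabeledGraph.twoLabelInterlace, DirectedMultigraph.circuitPartitionFunction]
  symm
  refine Finset.sum_bij (fun P _ =>
    { phi := D.phiVertices C P
      chi := D.chiVertices C P
      psi := ∅
      disjoint_phi_chi := by
        rw [Finset.disjoint_left]
        intro v h1 h2
        exact (hchi P v).1 h2 ((hphi P v).1 h1)
      disjoint_phi_psi := Finset.disjoint_empty_right _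
      disjoint_chi_psi := Finset.disjoint_empty_right _
      union_eq := by
        ext v
        simp only [Finset.union_empty, Finset.mem_union, hphi, hchi, Finset.mem_univ, iff_true]
        exact em _ }) ?_ ?_ ?_ ?_
  · intro P _
    simp
  · intro P hP P' hP' h
    rw [hmem] at hP hP'
    have h' : D.chiVertices C P = D.chiVertices C P' := congrArg LabeledPartition.chi h
    refine hP.eq_of_succ_eq hP' (funext fun e => ?_)
    by_cases he : D.tgt e ∈ D.chiVertices C P
    · rw [hD.succ_eq_of_transition_ne hCP hP hρ ((hchi _ _).1 he),
        hD.succ_eq_of_transition_ne hCP hP' hρ ((hchi _ _).1 (h' ▸ he))]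
    · have he' : D.tgt e ∉ D.chiVertices C P' := h' ▸ he
      rw [hchi, not_not] at he he'
      rw [(hP.transition_eq_iff hCP).1 he e rfl, (hP'.transition_eq_iff hCP).1 he' e rfl]
  · intro Q hQ
    have hpsi : Q.psi = ∅ := (Finset.mem_filter.1 hQ).2
    -- Surjectivity: switch `C` exactly on `Q.chi`. This precomposes `succ` with a target-preserving
    -- injection, so the result is again a successor function.
    let f : E → E := fun e => if D.tgt e ∈ Q.chi then hCP.succ (ρ e) else hCP.succ e
    have hf : Function.Injective f := by
      intro e g h
      have key : ∀ e, f e = hCP.succ (if D.tgt e ∈ Q.chi then ρ e else e) := fun e =>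
        (apply_ite hCP.succ _ _ _).symm
      have h1 : ∀ e, D.tgt (if D.tgt e ∈ Q.chi then ρ e else e) = D.tgt e := by
        intro e
        split_ifs
        · exact hρ.tgt e
        · rfl
      rw [key, key] at h
      have h2 := hCP.succ_injective h
      have h3 : D.tgt e = D.tgt g := by rw [← h1 e, h2, h1]
      rw [h3] at h2
      split_ifs at h2
      · exact hρ.involutive.injective h2
      · exact h2
    have hfD : ∀ e, D.src (f e) = D.tgt e := by
      intro e
      simp only [f]
      split_ifs
      · rw [hCP.src_succ, hρ.tgt]
      · rw [hCP.src_succ]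
    obtain ⟨P, hP, hPf⟩ := DirectedMultigraph.exists_isCircuitPartition_succ_eq hf hfD
    refine ⟨P, (hmem P).2 hP, ?_⟩
    have h1 : ∀ v, D.transition P v = D.transition C.circuits v ↔ v ∉ Q.chi := by
      intro v
      rw [hP.transition_eq_iff hCP, hPf]
      constructor
      · intro h hv
        obtain ⟨e, rfl⟩ := hD.surjective_tgt v
        have h2 := h e rfl
        simp only [f, if_pos hv] at h2
        exact hρ.ne e (hCP.succ_injective h2)
      · rintro hv e rfl
        simp only [f, if_neg hv]
    have h2 : ∀ v, v ∈ Q.phi ↔ v ∉ Q.chi := by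
      intro v
      have h3 := Finset.ext_iff.1 Q.union_eq v
      simp only [hpsi, Finset.union_empty, Finset.mem_union, Finset.mem_univ, iff_true] at h3
      exact ⟨fun h => Finset.disjoint_left.1 Q.disjoint_phi_chi h, h3.resolve_right⟩
    have h3 : D.phiVertices C P = Q.phi := by
      ext v
      rw [hphi, h1, h2]
    have h4 : D.chiVertices C P = Q.chi := by
      ext v
      rw [hchi, Ne, h1, not_not]
    obtain ⟨phi, chi, psi, _, _, _, _⟩ := Q
    simp only [LabeledPartition.mk.injEq]
    exact ⟨h3, h4, hpsi.symm⟩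
  · intro P hP
    rw [hmem] at hP
    congr 2
    rw [← hC.card_eq_numComponents]
    -- The switched vertices are those outside `φ_C(P)`, the vertices kept in the graph; as `psi` is
    -- empty, no loops are attached.
    refine Nat.sub_eq_of_eq_add' (hC.card_eq_card_add_nullity hP hρ hD.surjective_tgt ?_ ?_ _ ?_)
    · intro e he
      exact hD.succ_eq_of_transition_ne hCP hP hρ (mt (hphi _ _).2 he)
    · intro e he
      exact (hP.transition_eq_iff hCP).1 ((hphi _ _).1 (not_not.1 he)) e rfl
    · intro v w
      change D.Interlaced _ _ _ ∨ (v = w ∧ v.1 ∈ (∅ : Finset V)) ↔ _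
      simp
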